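/- Let $V$ be a finite set and let every edge $\{u,v\}$ of the complete graph on $V$ be labelled $+$ or $-$. The number of mistakes of a partition (clustering) of $V$ is the number of $+$ edges joining different clusters plus the number of $-$ edges inside clusters. Let $OPT$ be a partition of $V$ with the minimum number $C_{OPT}$ of mistakes, and suppose that an oracle can be queried on a pair $\{u,v\}$ and answers whether $u$ and $v$ are in the same cluster of $OPT$ (and hence whether $OPT$ makes a mistake on $\{u,v\}$). For $p\in[0,1]$, the algorithm $\mathrm{RandomQueryPivot}(p)$ maintains the set $S$ of vertices not yet clustered, initially $S=V$. While $S\neq\emptyset$, it picks a pivot $u\in S$ uniformly at random and goes, in an arbitrary order, once through each $(+,+,-)$ triangle $\{u,v,w\}\subseteq S$ containing $u$ (a triangle with exactly two $+$ edges), where $v$ is named so that $\{u,v\}$ is a $+$ edge. With probability $1-p$, independently for each triangle, the triangle is skipped. Otherwise the algorithm queries $\{u,v\}$; then, if $\{u,w\}$ is a $+$ edge or if $OPT$ makes no mistake on $\{u,v\}$, it also queries $\{u,w\}$. Answers are remembered, so that a pair already queried is not queried (or counted) again. The algorithm decides to make a mistake on exactly those queried edges on which $OPT$ makes a mistake. When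 all triangles at $u$ have been treated, the cluster of $u$ consists of $u$, the $v\in S$ with $\{u,v\}$ a $+$ edge on which it has not decided to make a mistake, and the $v\in S$ with $\{u,v\}$ a $-$ edge on which it has decided to make a mistake. This cluster is output and removed from $S$. Then for $p=1/4$ the output of $\mathrm{RandomQueryPivot}(p)$ is always a partition of $V$, the expected number of mistakes of this partition is at most $2\,C_{OPT}$, and the expected number of oracle queries made is at most $C_{OPT}$. -/

import Mathlib

namespace CorrelationClustering

open scoped NNReal ENNReal

/-! A complete graph on `V` with edges labelled `+` or `-` is given by the simple graph `G` of its
`+` edges: for `u ≠ v`, the edge `{u, v}` is `+` if `G.Adj u v` and `-` otherwise. -/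

/-- Some cluster of the family `P` contains both `u` and `v`. -/
def Together {V : Type*} (P : Finset (Finset V)) (u v : V) : Prop :=
  ∃ C ∈ P, u ∈ C ∧ v ∈ C

instance {V : Type*} [DecidableEq V] (P : Finset (Finset V)) (u v : V) :
    Decidable (Together P u v) :=
  inferInstanceAs (Decidable (∃ C ∈ P, u ∈ C ∧ v ∈ C))

theorem together_comm {V : Type*} (P : Finset (Finset V)) (u v : V) :
    Together P u v = Together P v u := by
  simp only [Together, and_comm]

/-- The predicate `Together` on unordered pairs. -/
def TogetherPair {V : Type*} (P : Finset (Finset V)) : Sym2 V → Prop :=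
  Sym2.lift ⟨Together P, together_comm P⟩

open Classical in
/-- The number of mistakes (disagreements) of the clustering `P`: the `+` edges between different
clusters plus the `-` edges inside clusters. -/
noncomputable def mistakes {V : Type*} [Fintype V] [DecidableEq V] (G : SimpleGraph V)
    [DecidableRel G.Adj] (P : Finset (Finset V)) : ℕ :=
  (G.edgeFinset.filter fun e => ¬ TogetherPair P e).card +
    (Gᶜ.edgeFinset.filter fun e => TogetherPair P e).card

/-- `OPT` is an optimal clustering: no partition of the vertex set makes fewer mistakes. -/
def IsOptimal {V : Type*} [Fintype V] [DecidableEq V] (G : SimpleGraph V)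
    [DecidableRel G.Adj] (OPT : Finpartition (Finset.univ : Finset V)) : Prop :=
  ∀ P : Finpartition (Finset.univ : Finset V), mistakes G OPT.parts ≤ mistakes G P.parts

/-- The same-cluster oracle of a clustering: "are `u` and `v` in the same cluster of `P`?" -/
def sameClusterOracle {V : Type*} [DecidableEq V] (P : Finset (Finset V)) (u v : V) : Bool :=
  decide (Together P u v)

/-- `u, v, w` are distinct and exactly two of the three edges between them are `+`. -/
def IsPPMTriangle {V : Type*} (G : SimpleGraph V) (u v w : V) : Prop :=
  u ≠ v ∧ u ≠ w ∧ v ≠ w ∧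
    ((G.Adj u v ∧ G.Adj u w ∧ ¬ G.Adj v w) ∨
      (G.Adj u v ∧ ¬ G.Adj u w ∧ G.Adj v w) ∨
      (¬ G.Adj u v ∧ G.Adj u w ∧ G.Adj v w))

/-- The list `l` runs, in some order, through all `(+,+,-)` triangles `{u, v, w}` with `v, w ∈ S`
that contain the pivot `u`. Each triangle occurs exactly once, as a pair `(v, w)` named so that
`{u, v}` is a `+` edge. -/
structure IsTriangleEnumeration {V : Type*} (G : SimpleGraph V) (S : Finset V) (u : V)
    (l : List (V × V)) : Prop where
  sound : ∀ t ∈ l, t.1 ∈ S ∧ t.2 ∈ S ∧ IsPPMTriangle G u t.1 t.2 ∧ G.Adj u t.1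
  complete : ∀ v ∈ S, ∀ w ∈ S, IsPPMTriangle G u v w → (v, w) ∈ l ∨ (w, v) ∈ l
  once : (l.map fun t => s(t.1, t.2)).Nodup

/-- The arrays kept while the triangles at a pivot `u` are scanned: the `v` for which the oracle
has been asked about `{u, v}`, and the `v` for which the algorithm has decided to make a mistake
on `{u, v}`. -/
structure ScanState (V : Type*) where
  queried : Finset V
  mistake : Finset V

/-- Query the edge `{u, v}`, unless this has been done before (the answer is then already
recorded). A mistake is recorded iff the oracle's answer disagrees with the label. -/
def query {V : Type*} [DecidableEq V] (G : SimpleGraph V) [DecidableRel G.Adj]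
    (O : V → V → Bool) (u v : V) (s : ScanState V) : ScanState V :=
  if v ∈ s.queried then s
  else
    { queried := insert v s.queried
      mistake := if O u v = decide (G.Adj u v) then s.mistake else insert v s.mistake }

/-- The queries for a selected triangle `{u, v, w}` in which `{u, v}` is `+`: first `{u, v}` is
queried; then `{u, w}` is queried if it is a `+` edge or if no mistake is made on `{u, v}`. -/
def processTriangle {V : Type*} [DecidableEq V] (G : SimpleGraph V) [DecidableRel G.Adj]
    (O : V → V → Bool) (u : V) (t : V × V) (s : ScanState V) : ScanState V :=
  let s₁ := query G O u t.1 s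
  if t.1 ∉ s₁.mistake ∨ G.Adj u t.2 then query G O u t.2 s₁ else s₁

/-- A coin that shows `true` with probability `p`. -/
noncomputable def coin (p : ℝ≥0) (hp : p ≤ 1) : PMF Bool :=
  PMF.ofFintype (fun b => cond b (p : ℝ≥0∞) (1 - (p : ℝ≥0∞))) (by
    simp [add_tsub_cancel_of_le (show (p : ℝ≥0∞) ≤ 1 by exact_mod_cast hp)])

/-- Scan a list of triangles at the pivot `u`. Each triangle is selected with probability `p`,
by a fresh coin, and skipped otherwise. -/
noncomputable def scan {V : Type*} [DecidableEq V] (G : SimpleGraph V) [DecidableRel G.Adj]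
    (O : V → V → Bool) (p : ℝ≥0) (hp : p ≤ 1) (u : V) :
    List (V × V) → ScanState V → PMF (ScanState V)
  | [], s => PMF.pure s
  | t :: l, s => (coin p hp).bind fun b =>
      scan G O p hp u l (if b then processTriangle G O u t s else s)

/-- The cluster of the pivot `u` among the remaining vertices `S`: `u` itself, its `+`-neighbours
without a recorded mistake, and its `-`-neighbours with a recorded mistake. -/
def pivotCluster {V : Type*} [DecidableEq V] (G : SimpleGraph V) [DecidableRel G.Adj]
    (S : Finset V) (u : V) (mistake : Finset V) : Finset V :=
  S.filter fun v => v = u ∨ (G.Adj u v ∧ v ∉ mistake) ∨ (¬ G.Adj u v ∧ v ∈ mistake)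

/-- The result of a run: the clusters formed, and the number of oracle queries made. -/
structure Output (V : Type*) where
  clusters : Finset (Finset V)
  queries : ℕ

theorem card_sdiff_pivotCluster_lt {V : Type*} [DecidableEq V] (G : SimpleGraph V)
    [DecidableRel G.Adj] (S : Finset V) (u : S) (M : Finset V) :
    (S \ pivotCluster G S u M).card < S.card := by
  apply Finset.card_lt_card
  refine (Finset.ssubset_iff_of_subset Finset.sdiff_subset).2 ⟨u, u.2, ?_⟩
  simp [pivotCluster]

/-- The algorithm `RandomQueryPivot(p)` on the remaining vertices `S`, as the probability
distribution of its output. `order S u` is the order in which it scans the `(+,+,-)` triangles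
inside `S` at the pivot `u`. -/
noncomputable def randomQueryPivot {V : Type*} [DecidableEq V] (G : SimpleGraph V)
    [DecidableRel G.Adj] (O : V → V → Bool) (order : Finset V → V → List (V × V))
    (p : ℝ≥0) (hp : p ≤ 1) (S : Finset V) : PMF (Output V) :=
  if hS : S.Nonempty then
    haveI : Nonempty S := hS.to_subtype
    (PMF.uniformOfFintype S).bind fun u =>
      (scan G O p hp u (order S u) ⟨∅, ∅⟩).bind fun s =>
        (randomQueryPivot G O order p hp (S \ pivotCluster G S u s.mistake)).map fun r =>
          { clusters := insert (pivotCluster G S u s.mistake) r.clusters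
            queries := s.queried.card + r.queries }
  else PMF.pure ⟨∅, 0⟩
termination_by S.card
decreasing_by exact card_sdiff_pivotCluster_lt G S u s.mistake

/-- The expectation of a natural-number-valued function, as an extended nonnegative real. -/
noncomputable def expectation {α : Type*} (μ : PMF α) (f : α → ℕ) : ℝ≥0∞ :=
  ∑' a, μ a * (f a : ℝ≥0∞)

theorem quarter_le_one : (1 / 4 : ℝ≥0) ≤ 1 := by
  rw [← NNReal.coe_le_coe]; norm_num

end CorrelationClustering

/-!
Fix the reference clustering `OPT`; only the fact that "same cluster" is an equivalence relation is
used, not optimality. The number of mistakes of `OPT` among the remaining vertices `S` serves as a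
potential. By induction on `S` (`mean_randomQueryPivot_le`) it suffices to compare, for one round
with a uniformly random pivot in `S`, the expected number of mistakes (`sum_pivotExp_excess_nonpos`)
and of queries (`sum_pivotExp_card_le`) with the expected number of mistakes of `OPT` that are
removed together with the cluster of the pivot.

At a pivot `u`, the answers are recorded faithfully, so the state of the scan is determined by the
set `Q` of queried edges (`mean_scan`), and the edge `{u, v}` is missed with probability
`h(u, v) = (3/4) ^ t`, where `t` is the number of triangles whose selection causes its query. If
`OPT` makes a mistake on `{u, v}`, then `t`, and hence `h`, is symmetric in `u` and `v`
(`queryCount_comm`).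

*Mistakes.* Give each edge that meets the new cluster the excess one for a mistake of the algorithm,
minus two for a mistake of `OPT`. An edge `{u, v}` at the pivot has expected excess `-(1 + h(u, v))`
if `OPT` errs on it, and `0` otherwise. All other edges are opposite to the pivot in a triple, and
the three choices of the pivot in a triple are considered together (`tripleBound_cyclic`). Their
total excess is at most `0`, except in a `(+,+,-)` triangle on which `OPT` makes a single mistake
`e`, where it is at most `2 h(e) - 1`. If an edge `e` is the single mistake in `k` triangles, then
`k ≤ t`, and `k (2 h(e) - 1) ≤ 2 (1 + h(e))`: for `k ≤ 2` because `h(e) ≤ 1`, and for `3 ≤ k`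
because then `h(e) ≤ (3/4) ^ 3 < 1/2`. So the excess at the two endpoints of `e` makes up for all of
these triangles (`sum_soleErrExcess_le`).

*Queries.* A query that finds a mistake of `OPT` is paid for by that mistake, which is removed with
the pivot. Over the three choices of the pivot, a triangle causes at most four other queries, each
if it is selected, that is with probability `1/4`; and if it causes any, then for some pivot in the
triangle the opposite edge is a mistake of `OPT` that is certainly removed (`idleQuery_cyclic`).
-/

namespace CorrelationClustering

open scoped NNReal ENNReal

/-! ### Mistakes of the reference clustering -/

/-- The properties of a same-cluster oracle that the analysis uses: "same cluster" is a symmetric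
and transitive relation. Optimality of the clustering plays no role. -/
structure IsClusterOracle {V : Type*} (O : V → V → Bool) : Prop where
  symm : ∀ x y, O x y = O y x
  trans : ∀ x y z, O x y = true → O y z = true → O x z = true

/-- The reference clustering, known through its oracle `O`, makes a mistake on the edge `{u, v}`.
The condition `u ≠ v` excludes the diagonal, where the oracle answers "same cluster" although
`u` is not adjacent to itself. -/
def Errs {V : Type*} (G : SimpleGraph V) [DecidableRel G.Adj] (O : V → V → Bool) (u v : V) : Prop :=
  u ≠ v ∧ O u v ≠ decide (G.Adj u v)

theorem errs_comm {V : Type*} {G : SimpleGraph V} [DecidableRel G.Adj]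
    {O : V → V → Bool} (hO : IsClusterOracle O) (x y : V) : Errs G O x y ↔ Errs G O y x := by
  simp only [Errs, hO.symm x y, G.adj_comm x y, ne_comm]

/-- Transitivity of the oracle in terms of labels and mistakes: for `x ≠ y`, it answers "same
cluster" on `{x, y}` exactly if `G.Adj x y` and `Errs G O x y` are not equivalent, and it cannot do
so on exactly two edges of a triple. -/
theorem IsClusterOracle.not_exactly_one_apart {V : Type*} {G : SimpleGraph V} [DecidableRel G.Adj]
    {O : V → V → Bool} (hO : IsClusterOracle O) (u v w : V) (hwu : w ≠ u) :
    ¬ (¬ (G.Adj u v ↔ Errs G O u v) ∧ ¬ (G.Adj v w ↔ Errs G O v w) ∧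
      (G.Adj w u ↔ Errs G O w u)) := by
  have := hO.trans u v w
  have := hO.symm u w
  have := hO.symm v w
  unfold Errs; grind

theorem isPPMTriangle_swap {V : Type*} {G : SimpleGraph V} {u v w : V} :
    IsPPMTriangle G u v w ↔ IsPPMTriangle G u w v := by
  have := G.adj_comm v w
  unfold IsPPMTriangle; grind

variable {V : Type*} [DecidableEq V]

/-! ### Expectations over the random selection of triangles -/

/-- The expectation of `f Q`, where `Q` is obtained from an initial set by scanning a list of
triangles: each triangle `t` of the list is independently selected with probability `p`, and then
all of `q t` is added to the set. The value is real, so that inequalities between such expectations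
can be proved with subtraction. -/
noncomputable def scanExp (p : ℝ) (q : V × V → Finset V) (f : Finset V → ℝ) :
    List (V × V) → Finset V → ℝ
  | [], Q => f Q
  | t :: l, Q => p * scanExp p q f l (Q ∪ q t) + (1 - p) * scanExp p q f l Q

section scanExp
variable {p : ℝ} {q : V × V → Finset V}

/-- Monotonicity of `scanExp`. The integrands need only be compared on subsets of `S`, if only
elements of `S` are ever added. -/
theorem scanExp_mono (hp : 0 ≤ p) (hp' : p ≤ 1) {S : Finset V} {f g : Finset V → ℝ}
    (hfg : ∀ Q ⊆ S, f Q ≤ g Q) (l : List (V × V)) (hl : ∀ t ∈ l, q t ⊆ S)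
    (Q : Finset V) (hQ : Q ⊆ S) : scanExp p q f l Q ≤ scanExp p q g l Q := by
  induction l generalizing Q with
  | nil => exact hfg Q hQ
  | cons t l ih =>
    have hl' : ∀ t ∈ l, q t ⊆ S := fun t ht => hl t (List.mem_cons_of_mem _ ht)
    have h1 := ih hl' (Q ∪ q t) (Finset.union_subset hQ (hl t List.mem_cons_self))
    have h2 := ih hl' Q hQ
    have hp1 : 0 ≤ 1 - p := sub_nonneg.2 hp'
    simp only [scanExp]
    gcongr

theorem scanExp_const (c : ℝ) (l : List (V × V)) (Q : Finset V) :
    scanExp p q (fun _ => c) l Q = c := by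
  induction l generalizing Q with
  | nil => rfl
  | cons t l ih => simp only [scanExp, ih]; ring

theorem scanExp_add (f g : Finset V → ℝ) (l : List (V × V)) (Q : Finset V) :
    scanExp p q (fun Q => f Q + g Q) l Q = scanExp p q f l Q + scanExp p q g l Q := by
  induction l generalizing Q with
  | nil => rfl
  | cons t l ih => simp only [scanExp, ih]; ring

theorem scanExp_const_mul (c : ℝ) (f : Finset V → ℝ) (l : List (V × V)) (Q : Finset V) :
    scanExp p q (fun Q => c * f Q) l Q = c * scanExp p q f l Q := by
  induction l generalizing Q with
  | nil => rfl
  | cons t l ih => simp only [scanExp, ih]; ring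

theorem scanExp_sum {ι : Type*} (s : Finset ι) (f : ι → Finset V → ℝ) (l : List (V × V))
    (Q : Finset V) :
    scanExp p q (fun Q => ∑ i ∈ s, f i Q) l Q = ∑ i ∈ s, scanExp p q (f i) l Q := by
  induction l generalizing Q with
  | nil => rfl
  | cons t l ih => simp only [scanExp, ih, Finset.mul_sum, Finset.sum_add_distrib]

/-- An element is missed exactly if none of the triangles that would add it is selected. -/
theorem scanExp_notMem (v : V) (l : List (V × V)) (Q : Finset V) :
    scanExp p q (fun Q => if v ∈ Q then 0 else 1) l Q =
      if v ∈ Q then 0 else (1 - p) ^ l.countP (fun t => v ∈ q t) := by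
  induction l generalizing Q with
  | nil => simp [scanExp]
  | cons t l ih =>
    simp only [scanExp, ih, Finset.mem_union, List.countP_cons]
    by_cases hQ : v ∈ Q <;> by_cases ht : v ∈ q t <;> simp [hQ, ht] <;> ring

end scanExp

/-! ### The queried edges and the cluster at a pivot -/

instance (G : SimpleGraph V) [DecidableRel G.Adj] (O : V → V → Bool) (u v : V) :
    Decidable (Errs G O u v) :=
  inferInstanceAs (Decidable (u ≠ v ∧ O u v ≠ decide (G.Adj u v)))

instance (G : SimpleGraph V) [DecidableRel G.Adj] (u v w : V) :
    Decidable (IsPPMTriangle G u v w) :=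
  inferInstanceAs (Decidable (u ≠ v ∧ u ≠ w ∧ v ≠ w ∧
    ((G.Adj u v ∧ G.Adj u w ∧ ¬ G.Adj v w) ∨
      (G.Adj u v ∧ ¬ G.Adj u w ∧ G.Adj v w) ∨
      (¬ G.Adj u v ∧ G.Adj u w ∧ G.Adj v w))))

/-- The endpoints `x` of the edges `{u, x}` whose answers are asked for, or already on record, when
the selected triangle `{u, t.1, t.2}` is treated at the pivot `u`. The set does not depend on the
state of the scan, because the answer for `{u, t.1}`, which decides about the second query, is
always known by then. -/
def toQuery (G : SimpleGraph V) [DecidableRel G.Adj] (O : V → V → Bool) (u : V) (t : V × V) :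
    Finset V :=
  if ¬ Errs G O u t.1 ∨ G.Adj u t.2 then {t.1, t.2} else {t.1}

/-- When the cluster `C` is split off, the algorithm makes a mistake on the edge `{x, y}`: the edge
meets `C`, and it lies inside `C` and is `-`, or leaves `C` and is `+`. -/
def AlgErrs (G : SimpleGraph V) (C : Finset V) (x y : V) : Prop :=
  x ≠ y ∧ (x ∈ C ∨ y ∈ C) ∧ ((x ∈ C ∧ y ∈ C) ↔ ¬ G.Adj x y)

instance (G : SimpleGraph V) [DecidableRel G.Adj] (C : Finset V) (x y : V) :
    Decidable (AlgErrs G C x y) :=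
  inferInstanceAs (Decidable (x ≠ y ∧ (x ∈ C ∨ y ∈ C) ∧ ((x ∈ C ∧ y ∈ C) ↔ ¬ G.Adj x y)))

/-- The edge `{x, y}` is a mistake of the reference clustering that disappears from the remaining
graph when the cluster `C` is split off. -/
def Removed (G : SimpleGraph V) [DecidableRel G.Adj] (O : V → V → Bool) (C : Finset V)
    (x y : V) : Prop :=
  Errs G O x y ∧ (x ∈ C ∨ y ∈ C)

instance (G : SimpleGraph V) [DecidableRel G.Adj] (O : V → V → Bool) (C : Finset V) (x y : V) :
    Decidable (Removed G O C x y) :=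
  inferInstanceAs (Decidable (Errs G O x y ∧ (x ∈ C ∨ y ∈ C)))

/-- The cluster of the pivot `u` among the remaining vertices `S`, if the edges `{u, x}` with
`x ∈ Q` have been queried. -/
def clusterOf (G : SimpleGraph V) [DecidableRel G.Adj] (O : V → V → Bool) (S : Finset V)
    (u : V) (Q : Finset V) : Finset V :=
  pivotCluster G S u (Q.filter (Errs G O u))

/-- The number of triangles at the pivot `u` whose selection causes the edge `{u, v}` to be
queried. -/
def queryCount (G : SimpleGraph V) [DecidableRel G.Adj] (O : V → V → Bool) (S : Finset V)
    (u v : V) : ℕ :=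
  (S.filter fun w => IsPPMTriangle G u v w ∧ (G.Adj u v ∨ ¬ Errs G O u w)).card

variable {G : SimpleGraph V} [DecidableRel G.Adj] {O : V → V → Bool} {S : Finset V} {u v w : V}

/-- The order of the list and the choice of the name `v` in triangles with two `+` edges at the
pivot do not influence which triangles cause a given query. -/
theorem countP_mem_toQuery {l : List (V × V)} (hl : IsTriangleEnumeration G S u l) (v : V)
    (hv : v ∈ S) :
    l.countP (fun t => v ∈ toQuery G O u t) = queryCount G O S u v := by
  have key : ((l.filter fun t => v ∈ toQuery G O u t).map fun t => s(t.1, t.2)).toFinset =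
      (S.filter fun w => IsPPMTriangle G u v w ∧ (G.Adj u v ∨ ¬ Errs G O u w)).image
        fun w => s(v, w) := by
    ext e
    simp only [List.mem_toFinset, List.mem_map, List.mem_filter, Finset.mem_image,
      Finset.mem_filter, decide_eq_true_eq]
    constructor
    · rintro ⟨⟨a, b⟩, ⟨ht, hq⟩, rfl⟩
      obtain ⟨ha, hb, htri, hadj⟩ := hl.sound _ ht
      dsimp only at ha hb htri hadj
      have hsw : IsPPMTriangle G u b a := by
        have := G.adj_comm a b
        unfold IsPPMTriangle at htri ⊢; tauto
      unfold toQuery at hq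
      split_ifs at hq with hc
      · simp only [Finset.mem_insert, Finset.mem_singleton] at hq
        rcases hq with rfl | rfl
        · exact ⟨b, ⟨hb, htri, Or.inl hadj⟩, rfl⟩
        · exact ⟨a, ⟨ha, hsw, hc.symm⟩, Sym2.eq_swap⟩
      · simp only [Finset.mem_singleton] at hq
        subst hq
        exact ⟨b, ⟨hb, htri, Or.inl hadj⟩, rfl⟩
    · rintro ⟨w, ⟨hw, htri, hc⟩, rfl⟩
      rcases hl.complete v hv w hw htri with h | h
      · refine ⟨(v, w), ⟨h, ?_⟩, rfl⟩
        unfold toQuery; split_ifs <;> simp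
      · refine ⟨(w, v), ⟨h, ?_⟩, Sym2.eq_swap⟩
        unfold toQuery
        rw [if_pos (by tauto)]; simp
  have hnd : ((l.filter fun t => v ∈ toQuery G O u t).map fun t => s(t.1, t.2)).Nodup :=
    hl.once.sublist (List.filter_sublist.map _)
  have := congrArg Finset.card key
  rw [List.toFinset_card_of_nodup hnd, List.length_map, ← List.countP_eq_length_filter,
    Finset.card_image_of_injective _ (fun a b h => Sym2.congr_right.1 h)] at this
  exact this

/-- For a mistake `{u, v}` of the reference clustering, the triangles that reveal it at the pivot
`u` are those that reveal it at the pivot `v`: if `{u, v}` is `+`, these are all `(+,+,-)` triangles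
on the edge; if it is `-`, those whose three vertices are in one cluster. -/
theorem queryCount_comm (hO : IsClusterOracle O) (h : Errs G O u v) :
    queryCount G O S u v = queryCount G O S v u := by
  unfold queryCount
  congr 1
  ext w
  have h1 := hO.trans u v w
  have h2 := hO.trans v u w
  have := hO.symm u v
  have := G.adj_comm u v
  simp only [IsPPMTriangle, Errs] at *
  grind

theorem toQuery_subset {l : List (V × V)} (hl : IsTriangleEnumeration G S u l) :
    ∀ t ∈ l, toQuery G O u t ⊆ S := by
  intro t ht
  obtain ⟨ha, hb, -⟩ := hl.sound _ ht
  unfold toQuery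
  split_ifs
  · exact Finset.insert_subset ha (Finset.singleton_subset_iff.2 hb)
  · exact Finset.singleton_subset_iff.2 ha

theorem mem_clusterOf {Q : Finset V} (hv : v ∈ S) (huv : u ≠ v) :
    v ∈ clusterOf G O S u Q ↔
      (G.Adj u v ∧ ¬ (v ∈ Q ∧ Errs G O u v)) ∨ (¬ G.Adj u v ∧ (v ∈ Q ∧ Errs G O u v)) := by
  simp [clusterOf, pivotCluster, hv, huv.symm]

theorem self_mem_clusterOf {Q : Finset V} (hu : u ∈ S) : u ∈ clusterOf G O S u Q := by
  simp [clusterOf, pivotCluster, hu]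

/-! ### The expected excess at a pivot -/

/-- The probability, for selection probability `1 / 4`, that the edge `{u, v}` is not queried at the
pivot `u`. -/
noncomputable def missProb (G : SimpleGraph V) [DecidableRel G.Adj] (O : V → V → Bool)
    (S : Finset V) (u v : V) : ℝ :=
  (3 / 4) ^ queryCount G O S u v

/-- The excess charged to the edge `{x, y}` when the cluster `C` is split off: one for a mistake of
the algorithm, minus two for a mistake of the reference clustering that is removed. -/
noncomputable def excess (G : SimpleGraph V) [DecidableRel G.Adj] (O : V → V → Bool)
    (C : Finset V) (x y : V) : ℝ :=
  (if AlgErrs G C x y then 1 else 0) - 2 * (if Removed G O C x y then 1 else 0)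

/-- The expectation of `f Q`, where `Q` is the set of vertices `x` for which the edge `{u, x}` is
queried while the list `l` of triangles at the pivot `u` is scanned, for selection probability
`1 / 4`. -/
noncomputable def pivotExp (G : SimpleGraph V) [DecidableRel G.Adj] (O : V → V → Bool)
    (l : List (V × V)) (u : V) (f : Finset V → ℝ) : ℝ :=
  scanExp (1 / 4) (toQuery G O u) f l ∅

variable {l : List (V × V)}

theorem missProb_nonneg : 0 ≤ missProb G O S u v := by unfold missProb; positivity

theorem missProb_le_one : missProb G O S u v ≤ 1 :=
  pow_le_one₀ (by norm_num) (by norm_num)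

theorem missProb_comm (hO : IsClusterOracle O) (h : Errs G O u v) :
    missProb G O S u v = missProb G O S v u := by
  unfold missProb; rw [queryCount_comm hO h]

theorem pivotExp_mono (hl : IsTriangleEnumeration G S u l) {f g : Finset V → ℝ}
    (hfg : ∀ Q ⊆ S, f Q ≤ g Q) : pivotExp G O l u f ≤ pivotExp G O l u g :=
  scanExp_mono (by norm_num) (by norm_num) hfg l (toQuery_subset hl) ∅ (Finset.empty_subset _)

theorem pivotExp_congr (hl : IsTriangleEnumeration G S u l) {f g : Finset V → ℝ}
    (hfg : ∀ Q ⊆ S, f Q = g Q) : pivotExp G O l u f = pivotExp G O l u g :=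
  le_antisymm (pivotExp_mono hl fun Q hQ => (hfg Q hQ).le)
    (pivotExp_mono hl fun Q hQ => (hfg Q hQ).ge)

theorem pivotExp_affine (hl : IsTriangleEnumeration G S u l) (hv : v ∈ S) (a b : ℝ) :
    pivotExp G O l u (fun Q => a + b * if v ∈ Q then 0 else 1) =
      a + b * missProb G O S u v := by
  unfold pivotExp
  rw [scanExp_add, scanExp_const, scanExp_const_mul, scanExp_notMem, countP_mem_toQuery hl v hv]
  norm_num [missProb]

theorem pivotExp_le_affine (hl : IsTriangleEnumeration G S u l) (hv : v ∈ S)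
    {f : Finset V → ℝ} (a b : ℝ) (h : ∀ Q ⊆ S, f Q ≤ a + b * if v ∈ Q then 0 else 1) :
    pivotExp G O l u f ≤ a + b * missProb G O S u v :=
  (pivotExp_mono hl h).trans (pivotExp_affine hl hv a b).le

/-- The expected excess of the edge `{v, w}` opposite to the pivot `u`, where `l` lists the
triangles at `u`. It is set to `0` unless the three vertices are distinct. For its bounds, note that
a vertex `x` joins the cluster of `u` as the oracle says if `{u, x}` is queried or the reference
clustering makes no mistake on `{u, x}`, and as the label of `{u, x}` says otherwise. -/
noncomputable def tripleExcess (G : SimpleGraph V) [DecidableRel G.Adj] (O : V → V → Bool)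
    (S : Finset V) (l : List (V × V)) (u v w : V) : ℝ :=
  if u ≠ v ∧ u ≠ w ∧ v ≠ w then
    pivotExp G O l u fun Q => excess G O (clusterOf G O S u Q) v w
  else 0

theorem excess_comm (hO : IsClusterOracle O) (C : Finset V) (x y : V) :
    excess G O C x y = excess G O C y x := by
  have h1 : AlgErrs G C x y ↔ AlgErrs G C y x := by
    simp only [AlgErrs, G.adj_comm x y, ne_comm, and_comm, or_comm]
  have h2 : Removed G O C x y ↔ Removed G O C y x := by
    simp only [Removed, errs_comm hO x y, or_comm]
  simp only [excess, h1, h2]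

theorem tripleExcess_comm (hO : IsClusterOracle O) :
    tripleExcess G O S l u v w = tripleExcess G O S l u w v := by
  unfold tripleExcess
  have : (u ≠ v ∧ u ≠ w ∧ v ≠ w) ↔ (u ≠ w ∧ u ≠ v ∧ w ≠ v) := by
    constructor <;> rintro ⟨h1, h2, h3⟩ <;> exact ⟨h2, h1, h3.symm⟩
  simp only [this, excess_comm hO _ v w]

theorem tripleExcess_le_affine (hl : IsTriangleEnumeration G S u l) (hv : v ∈ S)
    (huv : u ≠ v) (huw : u ≠ w) (hvw : v ≠ w) (a b : ℝ)
    (h : ∀ Q ⊆ S, excess G O (clusterOf G O S u Q) v w ≤ a + b * if v ∈ Q then 0 else 1) :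
    tripleExcess G O S l u v w ≤ a + b * missProb G O S u v := by
  unfold tripleExcess
  rw [if_pos ⟨huv, huw, hvw⟩]
  exact pivotExp_le_affine hl hv a b h

/-! ### Bounds for the expected excess of an edge opposite to the pivot -/

section bounds
variable (hO : IsClusterOracle O) (hl : IsTriangleEnumeration G S u l) (hv : v ∈ S) (hw : w ∈ S)
  (huv : u ≠ v) (huw : u ≠ w) (hvw : v ≠ w)
include hl hv huv huw hvw

theorem tripleExcess_le_one : tripleExcess G O S l u v w ≤ 1 := by
  have := tripleExcess_le_affine (O := O) (w := w) hl hv huv huw hvw 1 0 fun Q _ => by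
    unfold excess; split_ifs <;> norm_num
  linarith

/-- A mistake of the algorithm on an edge makes the edge disappear, so it is paid for if the
reference clustering makes a mistake on the same edge. -/
theorem tripleExcess_le_of_errs (h : Errs G O v w) : tripleExcess G O S l u v w ≤ 0 := by
  have := tripleExcess_le_affine (O := O) (w := w) hl hv huv huw hvw 0 0 fun Q _ => by
    unfold excess AlgErrs Removed
    split_ifs <;> norm_num <;> grind
  linarith

/-- Here `v` certainly joins the cluster of `u`, so `{v, w}` is certainly removed. -/
theorem tripleExcess_le_neg_one (h : Errs G O v w) (hA : G.Adj u v) (h' : ¬ Errs G O u v) :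
    tripleExcess G O S l u v w ≤ -1 := by
  have := tripleExcess_le_affine (O := O) (w := w) hl hv huv huw hvw (-1) 0 fun Q _ => by
    have hm := mem_clusterOf (G := G) (O := O) (Q := Q) hv huv
    unfold excess AlgErrs Removed
    split_ifs <;> norm_num <;> grind
  linarith

/-- Here `v` joins the cluster of `u` exactly if `{u, v}` is queried. -/
theorem tripleExcess_le_of_errs_of_not_adj (h : Errs G O v w) (hA : ¬ G.Adj u v)
    (h' : Errs G O u v) : tripleExcess G O S l u v w ≤ missProb G O S u v - 1 := by
  have := tripleExcess_le_affine (O := O) (w := w) hl hv huv huw hvw (-1) 1 fun Q _ => by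
    have hm := mem_clusterOf (G := G) (O := O) (Q := Q) hv huv
    unfold excess AlgErrs Removed
    split_ifs <;> norm_num <;> grind
  linarith

/-- Here `v` joins the cluster of `u` exactly if `{u, v}` is not queried. -/
theorem tripleExcess_le_of_errs_of_adj (h : Errs G O v w) (hA : G.Adj u v)
    (h' : Errs G O u v) : tripleExcess G O S l u v w ≤ - missProb G O S u v := by
  have := tripleExcess_le_affine (O := O) (w := w) hl hv huv huw hvw 0 (-1) fun Q _ => by
    have hm := mem_clusterOf (G := G) (O := O) (Q := Q) hv huv
    unfold excess AlgErrs Removed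
    split_ifs <;> norm_num <;> grind
  linarith

include hO hw

theorem tripleExcess_le_of_no_errs (h : ¬ Errs G O v w) (h₁ : ¬ Errs G O u v)
    (h₂ : ¬ Errs G O u w) : tripleExcess G O S l u v w ≤ 0 := by
  have := tripleExcess_le_affine (O := O) (w := w) hl hv huv huw hvw 0 0 fun Q _ => by
    have hm := mem_clusterOf (G := G) (O := O) (Q := Q) hv huv
    have hm' := mem_clusterOf (G := G) (O := O) (Q := Q) hw huw
    have t1 := hO.trans v u w
    have t2 := hO.trans u v w
    have t3 := hO.trans u w v
    have := hO.symm u v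
    have := hO.symm v w
    unfold excess AlgErrs Removed
    unfold Errs at *
    split_ifs <;> norm_num <;> grind
  linarith

/-- If `{u, v}` is queried, both edges at the pivot are settled in accordance with the oracle, and
no mistake is made on `{v, w}`. -/
theorem tripleExcess_le_missProb (h : ¬ Errs G O v w) (h₁ : Errs G O u v)
    (h₂ : ¬ Errs G O u w) : tripleExcess G O S l u v w ≤ missProb G O S u v := by
  have := tripleExcess_le_affine (O := O) (w := w) hl hv huv huw hvw 0 1 fun Q _ => by
    have hm := mem_clusterOf (G := G) (O := O) (Q := Q) hv huv
    have hm' := mem_clusterOf (G := G) (O := O) (Q := Q) hw huw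
    have t1 := hO.trans v u w
    have t2 := hO.trans u v w
    have t3 := hO.trans u w v
    have := hO.symm u v
    have := hO.symm v w
    unfold excess AlgErrs Removed
    unfold Errs at *
    split_ifs <;> norm_num <;> grind
  linarith

theorem tripleExcess_le_zero_of_not_triangle (h : ¬ Errs G O v w) (h₁ : Errs G O u v)
    (h₂ : ¬ Errs G O u w) (ht : ¬ IsPPMTriangle G u v w) :
    tripleExcess G O S l u v w ≤ 0 := by
  have := tripleExcess_le_affine (O := O) (w := w) hl hv huv huw hvw 0 0 fun Q _ => by
    have hm := mem_clusterOf (G := G) (O := O) (Q := Q) hv huv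
    have hm' := mem_clusterOf (G := G) (O := O) (Q := Q) hw huw
    have t1 := hO.trans v u w
    have t2 := hO.trans u v w
    have t3 := hO.trans u w v
    have := hO.symm u v
    have := hO.symm v w
    unfold excess AlgErrs Removed
    unfold Errs IsPPMTriangle at *
    split_ifs <;> norm_num <;> grind
  linarith

/-- Unless `{u, v}` is queried, `v` stays outside the cluster of `u`, and `{v, w}` is a `-` edge. -/
theorem tripleExcess_le_of_mixed (h : ¬ Errs G O v w) (h₁ : Errs G O u v)
    (h₂ : Errs G O u w) (hA : ¬ G.Adj u v) (hA' : G.Adj u w) :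
    tripleExcess G O S l u v w ≤ 1 - missProb G O S u v := by
  have := tripleExcess_le_affine (O := O) (w := w) hl hv huv huw hvw 1 (-1) fun Q _ => by
    have hm := mem_clusterOf (G := G) (O := O) (Q := Q) hv huv
    have hm' := mem_clusterOf (G := G) (O := O) (Q := Q) hw huw
    have t1 := hO.trans v u w
    have t2 := hO.trans u v w
    have t3 := hO.trans u w v
    have := hO.symm u v
    have := hO.symm v w
    unfold excess AlgErrs Removed
    unfold Errs at *
    split_ifs <;> norm_num <;> grind
  linarith

/-- If `{u, v}` is queried, `v` stays outside the cluster of `u`, and `{v, w}` is a `-` edge. -/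
theorem tripleExcess_le_missProb_of_not_adj (h : ¬ Errs G O v w) (h₁ : Errs G O u v)
    (hA : G.Adj u v) (hA' : ¬ G.Adj v w) :
    tripleExcess G O S l u v w ≤ missProb G O S u v := by
  have := tripleExcess_le_affine (O := O) (w := w) hl hv huv huw hvw 0 1 fun Q _ => by
    have hm := mem_clusterOf (G := G) (O := O) (Q := Q) hv huv
    have hm' := mem_clusterOf (G := G) (O := O) (Q := Q) hw huw
    have t1 := hO.trans v u w
    have t2 := hO.trans u v w
    have t3 := hO.trans u w v
    have := hO.symm u v
    have := hO.symm v w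
    unfold excess AlgErrs Removed
    unfold Errs at *
    split_ifs <;> norm_num <;> grind
  linarith

end bounds

/-! ### The total excess of a triple, each of its vertices being the pivot once -/

/-- An upper bound for `tripleExcess` in terms of the labels, the mistakes of the reference
clustering and the probabilities `missProb`, obtained by collecting the bounds above. -/
noncomputable def tripleBound (G : SimpleGraph V) [DecidableRel G.Adj] (O : V → V → Bool)
    (S : Finset V) (u v w : V) : ℝ :=
  if Errs G O v w then
    if (G.Adj u v ∧ ¬ Errs G O u v) ∨ (G.Adj u w ∧ ¬ Errs G O u w) then -1
    else if Errs G O u v then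
      if G.Adj u v then - missProb G O S u v else missProb G O S u v - 1
    else if Errs G O u w then
      if G.Adj u w then - missProb G O S u w else missProb G O S u w - 1
    else 0
  else if Errs G O u v ∧ Errs G O u w then
    if G.Adj u v ∧ ¬ G.Adj u w then 1 - missProb G O S u w
    else if ¬ G.Adj u v ∧ G.Adj u w then 1 - missProb G O S u v
    else if G.Adj u v ∧ G.Adj u w ∧ ¬ G.Adj v w then missProb G O S u v
    else 1
  else if IsPPMTriangle G u v w then
    if Errs G O u v then missProb G O S u v
    else if Errs G O u w then missProb G O S u w
    else 0
  else 0

/-- The part of the excess of a triple that is charged to its edge `{u, v}`: it is nonzero only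
for a `(+,+,-)` triangle on which `{u, v}` is the only mistake of the reference clustering. -/
noncomputable def soleErrExcess (G : SimpleGraph V) [DecidableRel G.Adj] (O : V → V → Bool)
    (S : Finset V) (u v w : V) : ℝ :=
  if IsPPMTriangle G u v w ∧ Errs G O u v ∧ ¬ Errs G O u w ∧ ¬ Errs G O v w then
    2 * missProb G O S u v - 1
  else 0

theorem tripleExcess_le_tripleBound (hO : IsClusterOracle O) (hl : IsTriangleEnumeration G S u l)
    (hv : v ∈ S) (hw : w ∈ S) (huv : u ≠ v) (huw : u ≠ w) (hvw : v ≠ w) :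
    tripleExcess G O S l u v w ≤ tripleBound G O S u v w := by
  have hc := tripleExcess_comm (G := G) (S := S) (u := u) (v := v) (w := w) (l := l) hO
  have he := errs_comm (G := G) hO v w
  have ht := isPPMTriangle_swap (G := G) (u := u) (v := v) (w := w)
  have ha := G.adj_comm v w
  unfold tripleBound
  split_ifs with h1 h2 h3 h4 h5 h6 h7 h8 h9 h10 h11 h12 h13
  · rcases h2 with h2 | h2
    · exact tripleExcess_le_neg_one hl hv huv huw hvw h1 h2.1 h2.2
    · rw [hc]; exact tripleExcess_le_neg_one hl hw huw huv hvw.symm (he.1 h1) h2.1 h2.2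
  · exact tripleExcess_le_of_errs_of_adj hl hv huv huw hvw h1 h4 h3
  · exact tripleExcess_le_of_errs_of_not_adj hl hv huv huw hvw h1 h4 h3
  · rw [hc]; exact tripleExcess_le_of_errs_of_adj hl hw huw huv hvw.symm (he.1 h1) h6 h5
  · rw [hc]; exact tripleExcess_le_of_errs_of_not_adj hl hw huw huv hvw.symm (he.1 h1) h6 h5
  · exact tripleExcess_le_of_errs hl hv huv huw hvw h1
  · rw [hc]
    exact tripleExcess_le_of_mixed hO hl hw hv huw huv hvw.symm (mt he.2 h1) h7.2 h7.1 h8.2 h8.1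
  · exact tripleExcess_le_of_mixed hO hl hv hw huv huw hvw h1 h7.1 h7.2 h9.1 h9.2
  · exact tripleExcess_le_missProb_of_not_adj hO hl hv hw huv huw hvw h1 h7.1 h10.1 h10.2.2
  · exact tripleExcess_le_one hl hv huv huw hvw
  · exact tripleExcess_le_missProb hO hl hv hw huv huw hvw h1 h12 (fun h => h7 ⟨h12, h⟩)
  · rw [hc]
    exact tripleExcess_le_missProb hO hl hw hv huw huv hvw.symm (mt he.2 h1) h13
      (fun h => h7 ⟨h, h13⟩)
  · exact tripleExcess_le_of_no_errs hO hl hv hw huv huw hvw h1 h12 h13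
  · by_cases h12 : Errs G O u v
    · exact tripleExcess_le_zero_of_not_triangle hO hl hv hw huv huw hvw h1 h12
        (fun h => h7 ⟨h12, h⟩) h11
    · by_cases h13 : Errs G O u w
      · rw [hc]
        exact tripleExcess_le_zero_of_not_triangle hO hl hw hv huw huv hvw.symm (mt he.2 h1) h13
          h12 (mt ht.2 h11)
      · exact tripleExcess_le_of_no_errs hO hl hv hw huv huw hvw h1 h12 h13

/-- Over the three choices of the pivot in a triple, the removed mistakes of the reference
clustering pay for those of the algorithm, except in `(+,+,-)` triangles with a single mistake of
the reference clustering. There the edge `e` of that mistake is removed, at a gain of `1` in all,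
when the third vertex is the pivot, and with either endpoint of `e` as pivot a mistake is made if
`e` is not queried. -/
theorem tripleBound_cyclic (hO : IsClusterOracle O) (huv : u ≠ v) (huw : u ≠ w) (hvw : v ≠ w) :
    tripleBound G O S u v w + tripleBound G O S v w u + tripleBound G O S w u v ≤
      soleErrExcess G O S u v w + soleErrExcess G O S v w u + soleErrExcess G O S w u v := by
  -- `missProb` is symmetric only on mistakes of the reference clustering.
  have s1 : Errs G O u v → missProb G O S v u = missProb G O S u v :=
    fun h => (missProb_comm hO h).symm
  have s2 : Errs G O v w → missProb G O S w v = missProb G O S v w :=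
    fun h => (missProb_comm hO h).symm
  have s3 : Errs G O w u → missProb G O S u w = missProb G O S w u :=
    fun h => (missProb_comm hO h).symm
  have r1 := hO.not_exactly_one_apart (G := G) u v w huw.symm
  have r2 := hO.not_exactly_one_apart (G := G) w u v hvw
  have r3 := hO.not_exactly_one_apart (G := G) v w u huv
  have b1 := missProb_nonneg (G := G) (O := O) (S := S) (u := u) (v := v)
  have b2 := missProb_nonneg (G := G) (O := O) (S := S) (u := v) (v := w)
  have b3 := missProb_nonneg (G := G) (O := O) (S := S) (u := w) (v := u)
  have c1 := missProb_le_one (G := G) (O := O) (S := S) (u := u) (v := v)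
  have c2 := missProb_le_one (G := G) (O := O) (S := S) (u := v) (v := w)
  have c3 := missProb_le_one (G := G) (O := O) (S := S) (u := w) (v := u)
  unfold tripleBound soleErrExcess IsPPMTriangle
  simp only [G.adj_comm v u, G.adj_comm w v, G.adj_comm u w, errs_comm hO v u,
    errs_comm hO w v, errs_comm hO u w, huv, huw, hvw, huv.symm, huw.symm, hvw.symm,
    ne_eq, not_false_eq_true, true_and]
  generalize missProb G O S u v = x at *
  generalize missProb G O S v w = y at *
  generalize missProb G O S w u = z at *
  generalize missProb G O S v u = x' at *
  generalize missProb G O S w v = y' at *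
  generalize missProb G O S u w = z' at *
  by_cases e1 : Errs G O u v <;> by_cases e2 : Errs G O v w <;> by_cases e3 : Errs G O w u <;>
    simp only [e1, e2, e3, forall_const, iff_true, iff_false] at s1 s2 s3 r1 r2 r3 ⊢ <;>
    by_cases a1 : G.Adj u v <;> by_cases a2 : G.Adj v w <;> by_cases a3 : G.Adj w u <;>
    simp only [a1, a2, a3, not_true_eq_false, not_false_eq_true, and_true, and_false, or_true,
      or_false, if_true, if_false, and_self] at r1 r2 r3 ⊢ <;>
    linarith

theorem tripleExcess_cyclic (hO : IsClusterOracle O) {order : V → List (V × V)}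
    (hl : ∀ x ∈ S, IsTriangleEnumeration G S x (order x))
    (hu : u ∈ S) (hv : v ∈ S) (hw : w ∈ S) :
    tripleExcess G O S (order u) u v w + tripleExcess G O S (order v) v w u +
        tripleExcess G O S (order w) w u v ≤
      soleErrExcess G O S u v w + soleErrExcess G O S v w u + soleErrExcess G O S w u v := by
  by_cases h : u ≠ v ∧ u ≠ w ∧ v ≠ w
  · obtain ⟨huv, huw, hvw⟩ := h
    have h1 := tripleExcess_le_tripleBound hO (hl u hu) hv hw huv huw hvw
    have h2 := tripleExcess_le_tripleBound hO (hl v hv) hw hu hvw huv.symm huw.symm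
    have h3 := tripleExcess_le_tripleBound hO (hl w hw) hu hv huw.symm hvw.symm huv
    have h4 := tripleBound_cyclic (G := G) (S := S) hO huv huw hvw
    linarith
  · have h1 : ¬ (v ≠ w ∧ v ≠ u ∧ w ≠ u) := by grind
    have h2 : ¬ (w ≠ u ∧ w ≠ v ∧ u ≠ v) := by grind
    have : ∀ a b c : V, ¬ (a ≠ b ∧ a ≠ c ∧ b ≠ c) → ¬ IsPPMTriangle G a b c :=
      fun a b c h h' => h ⟨h'.1, h'.2.1, h'.2.2.1⟩
    unfold tripleExcess soleErrExcess
    simp only [h, h1, h2, this _ _ _ h, this _ _ _ h1, this _ _ _ h2, if_false, false_and]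
    exact le_refl _

/-! ### Mistakes in one round -/

theorem sum_rotate {V : Type*} (S : Finset V) (f : V → V → V → ℝ) :
    ∑ u ∈ S, ∑ v ∈ S, ∑ w ∈ S, f v w u = ∑ u ∈ S, ∑ v ∈ S, ∑ w ∈ S, f u v w := by
  rw [Finset.sum_comm]
  exact Finset.sum_congr rfl fun v _ => Finset.sum_comm

/-- Two sums over ordered triples can be compared cyclic orbit by cyclic orbit. -/
theorem sum_le_sum_of_cyclic {V : Type*} (S : Finset V) (f g : V → V → V → ℝ)
    (h : ∀ u ∈ S, ∀ v ∈ S, ∀ w ∈ S,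
      f u v w + f v w u + f w u v ≤ g u v w + g v w u + g w u v) :
    ∑ u ∈ S, ∑ v ∈ S, ∑ w ∈ S, f u v w ≤ ∑ u ∈ S, ∑ v ∈ S, ∑ w ∈ S, g u v w := by
  have h3 : ∀ f : V → V → V → ℝ, ∑ u ∈ S, ∑ v ∈ S, ∑ w ∈ S, (f u v w + f v w u + f w u v) =
      3 * ∑ u ∈ S, ∑ v ∈ S, ∑ w ∈ S, f u v w := by
    intro f
    simp only [Finset.sum_add_distrib]
    rw [sum_rotate S f, sum_rotate S fun a b c => f b c a, sum_rotate S f]; ring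
  have := Finset.sum_le_sum fun u hu => Finset.sum_le_sum fun v hv =>
    Finset.sum_le_sum fun w hw => h u hu v hv w hw
  rw [h3, h3] at this
  linarith

/-- A sum over ordered pairs, split into the pairs that contain `u` and those that do not. -/
theorem sum_pairs_eq_pivot_add_triples {S : Finset V} {u : V} (hu : u ∈ S) (φ : V → V → ℝ)
    (hφ : ∀ x y, φ x y = φ y x) (hd : ∀ x, φ x x = 0) :
    ∑ x ∈ S, ∑ y ∈ S, φ x y = 2 * ∑ v ∈ S, φ u v +
      ∑ v ∈ S, ∑ w ∈ S, if u ≠ v ∧ u ≠ w ∧ v ≠ w then φ v w else 0 := by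
  have h : ∀ x y, φ x y = (if x = u then φ u y else 0) + (if y = u then φ u x else 0) +
      if u ≠ x ∧ u ≠ y ∧ x ≠ y then φ x y else 0 := by
    intro x y
    have := hφ x u
    have := hd x
    grind
  rw [Finset.sum_congr rfl fun x _ => Finset.sum_congr rfl fun y _ => h x y]
  simp only [Finset.sum_add_distrib]
  have h1 : ∑ x ∈ S, ∑ y ∈ S, (if x = u then φ u y else 0) = ∑ v ∈ S, φ u v := by
    rw [Finset.sum_comm]; simp [hu]
  have h2 : ∑ x ∈ S, ∑ y ∈ S, (if y = u then φ u x else 0) = ∑ v ∈ S, φ u v := by simp [hu]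
  rw [h1, h2]; ring

theorem pivotExp_sum {ι : Type*} (s : Finset ι) (f : ι → Finset V → ℝ) :
    pivotExp G O l u (fun Q => ∑ i ∈ s, f i Q) = ∑ i ∈ s, pivotExp G O l u (f i) :=
  scanExp_sum s f l ∅

theorem pivotExp_const (c : ℝ) : pivotExp G O l u (fun _ => c) = c := scanExp_const c l ∅

theorem pivotExp_sum_pairs (hu : u ∈ S) (φ : Finset V → V → V → ℝ)
    (hφ : ∀ Q x y, φ Q x y = φ Q y x) (hd : ∀ Q x, φ Q x x = 0) :
    pivotExp G O l u (fun Q => ∑ x ∈ S, ∑ y ∈ S, φ Q x y) =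
      2 * ∑ v ∈ S, pivotExp G O l u (fun Q => φ Q u v) +
      ∑ v ∈ S, ∑ w ∈ S, if u ≠ v ∧ u ≠ w ∧ v ≠ w then pivotExp G O l u (fun Q => φ Q v w)
        else 0 := by
  simp only [sum_pairs_eq_pivot_add_triples hu (φ _) (hφ _) (hd _)]
  unfold pivotExp
  rw [scanExp_add, scanExp_const_mul, scanExp_sum, scanExp_sum]
  congr 1
  refine Finset.sum_congr rfl fun v _ => ?_
  rw [scanExp_sum]
  refine Finset.sum_congr rfl fun w _ => ?_
  split_ifs
  · rfl
  · exact scanExp_const 0 l ∅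

/-- On the edges at the pivot, the algorithm errs exactly where it has found a mistake of the
reference clustering, and all mistakes of the reference clustering are removed. -/
theorem pivotExp_excess_pivot (hl : IsTriangleEnumeration G S u l) (hu : u ∈ S) (hv : v ∈ S) :
    pivotExp G O l u (fun Q => excess G O (clusterOf G O S u Q) u v) =
      if Errs G O u v then - (1 + missProb G O S u v) else 0 := by
  have hC : ∀ Q, u ∈ clusterOf G O S u Q := fun Q => self_mem_clusterOf hu
  split_ifs with h
  · have := pivotExp_affine (O := O) hl hv (-1) (-1)
    rw [show -(1 + missProb G O S u v) = -1 + -1 * missProb G O S u v by ring, ← this]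
    refine pivotExp_congr hl fun Q _ => ?_
    have hm := mem_clusterOf (G := G) (O := O) (Q := Q) hv h.1
    have := hC Q
    unfold excess AlgErrs Removed
    have := h.1
    split_ifs <;> norm_num <;> grind
  · rw [← pivotExp_const (G := G) (O := O) (l := l) (u := u) 0]
    refine pivotExp_congr hl fun Q _ => ?_
    have := hC Q
    by_cases huv : u = v
    · subst huv; simp [excess, AlgErrs, Removed, h]
    · have hm := mem_clusterOf (G := G) (O := O) (Q := Q) hv huv
      unfold excess AlgErrs Removed
      split_ifs <;> norm_num <;> grind

/-- What the triangles charge to an edge `{u, v}` is covered by the gain on the edge itself when one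
of its endpoints is the pivot: if `k` triangles charge the edge, then `missProb G O S u v` is at
most `(3 / 4) ^ k`, so it is below `1 / 2` and the charge is negative as soon as `3 ≤ k`. -/
theorem sum_soleErrExcess_le (u v : V) :
    ∑ w ∈ S, soleErrExcess G O S u v w ≤
      if Errs G O u v then 2 * (1 + missProb G O S u v) else 0 := by
  unfold soleErrExcess
  split_ifs with h
  · rw [← Finset.sum_filter, Finset.sum_const, nsmul_eq_mul]
    set k := (S.filter fun w => IsPPMTriangle G u v w ∧ Errs G O u v ∧ ¬ Errs G O u w ∧
      ¬ Errs G O v w).card with hk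
    have hkt : k ≤ queryCount G O S u v :=
      Finset.card_le_card (Finset.monotone_filter_right _ fun w _ hw => ⟨hw.1, Or.inr hw.2.2.1⟩)
    have h0 := missProb_nonneg (G := G) (O := O) (S := S) (u := u) (v := v)
    have h1 := missProb_le_one (G := G) (O := O) (S := S) (u := u) (v := v)
    by_cases hk2 : k ≤ 2
    · have : (k : ℝ) ≤ 2 := by exact_mod_cast hk2
      have : (0 : ℝ) ≤ k := by positivity
      nlinarith
    · have : missProb G O S u v ≤ (3 / 4) ^ 3 :=
        pow_le_pow_of_le_one (by norm_num) (by norm_num) (by omega)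
      have : (0 : ℝ) ≤ k := by positivity
      nlinarith
  · simp [h]

/-- In one round, the expected number of mistakes of the algorithm is at most twice the expected
number of removed mistakes of the reference clustering. -/
theorem sum_pivotExp_excess_nonpos (hO : IsClusterOracle O) {order : V → List (V × V)}
    (hl : ∀ x ∈ S, IsTriangleEnumeration G S x (order x)) :
    ∑ u ∈ S, pivotExp G O (order u) u
      (fun Q => ∑ x ∈ S, ∑ y ∈ S, excess G O (clusterOf G O S u Q) x y) ≤ 0 := by
  have hd : ∀ C x, excess G O C x x = 0 := by
    intro C x; simp [excess, AlgErrs, Removed, Errs]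
  have h1 : ∀ u ∈ S, pivotExp G O (order u) u
      (fun Q => ∑ x ∈ S, ∑ y ∈ S, excess G O (clusterOf G O S u Q) x y) =
      2 * ∑ v ∈ S, (if Errs G O u v then - (1 + missProb G O S u v) else 0) +
      ∑ v ∈ S, ∑ w ∈ S, tripleExcess G O S (order u) u v w := by
    intro u hu
    rw [pivotExp_sum_pairs hu (fun Q => excess G O (clusterOf G O S u Q))
      (fun Q => excess_comm hO _) (fun Q => hd _)]
    congr 2
    exact Finset.sum_congr rfl fun v hv => pivotExp_excess_pivot (hl u hu) hu hv
  rw [Finset.sum_congr rfl h1, Finset.sum_add_distrib]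
  have h2 := sum_le_sum_of_cyclic S (fun u v w => tripleExcess G O S (order u) u v w)
    (soleErrExcess G O S) fun u hu v hv w hw => tripleExcess_cyclic hO hl hu hv hw
  have h3 : ∑ u ∈ S, ∑ v ∈ S, ∑ w ∈ S, soleErrExcess G O S u v w ≤
      - ∑ u ∈ S, 2 * ∑ v ∈ S, (if Errs G O u v then - (1 + missProb G O S u v) else 0) := by
    rw [← Finset.sum_neg_distrib]
    refine Finset.sum_le_sum fun u _ => ?_
    rw [Finset.mul_sum, ← Finset.sum_neg_distrib]
    refine Finset.sum_le_sum fun v _ => (sum_soleErrExcess_le u v).trans (le_of_eq ?_)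
    split_ifs <;> ring
  linarith

/-! ### Queries in one round -/

/-- If the triangle `{u, v, w}` is selected at the pivot `u`, then `{u, v}` is queried, and the
reference clustering makes no mistake on `{u, v}`. -/
def IdleQuery (G : SimpleGraph V) [DecidableRel G.Adj] (O : V → V → Bool) (u v w : V) : Prop :=
  ¬ Errs G O u v ∧ IsPPMTriangle G u v w ∧ (G.Adj u v ∨ ¬ Errs G O u w)

instance (G : SimpleGraph V) [DecidableRel G.Adj] (O : V → V → Bool) (u v w : V) :
    Decidable (IdleQuery G O u v w) :=
  inferInstanceAs (Decidable
    (¬ Errs G O u v ∧ IsPPMTriangle G u v w ∧ (G.Adj u v ∨ ¬ Errs G O u w)))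

/-- The probability that, at the pivot `u`, the opposite edge `{v, w}` is a mistake of the reference
clustering that is removed. It is set to `0` unless the three vertices are distinct. -/
noncomputable def tripleRemoved (G : SimpleGraph V) [DecidableRel G.Adj] (O : V → V → Bool)
    (S : Finset V) (l : List (V × V)) (u v w : V) : ℝ :=
  if u ≠ v ∧ u ≠ w ∧ v ≠ w then
    pivotExp G O l u fun Q => if Removed G O (clusterOf G O S u Q) v w then 1 else 0
  else 0

theorem le_tripleRemoved (hl : IsTriangleEnumeration G S u l)
    (hv : v ∈ S) (hw : w ∈ S) (huv : u ≠ v) (huw : u ≠ w) (hvw : v ≠ w) :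
    (if Errs G O v w ∧ ((G.Adj u v ∧ ¬ Errs G O u v) ∨ (G.Adj u w ∧ ¬ Errs G O u w)) then 1
      else 0) ≤ tripleRemoved G O S l u v w := by
  unfold tripleRemoved
  have hd : u ≠ v ∧ u ≠ w ∧ v ≠ w := ⟨huv, huw, hvw⟩
  rw [if_pos hd]
  refine (pivotExp_const (G := G) (O := O) (l := l) (u := u) _).ge.trans ?_
  refine pivotExp_mono hl fun Q _ => ?_
  have hm := mem_clusterOf (G := G) (O := O) (Q := Q) hv huv
  have hm' := mem_clusterOf (G := G) (O := O) (Q := Q) hw huw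
  unfold Removed
  split_ifs <;> grind

/-- A triangle causes at most four queries that find no mistake, over the three choices of the pivot
in it; and if it causes any, then some choice of the pivot certainly removes a mistake on the
opposite edge. Hence the selection probability `1 / 4`. -/
theorem idleQuery_cyclic (hO : IsClusterOracle O) {order : V → List (V × V)}
    (hl : ∀ x ∈ S, IsTriangleEnumeration G S x (order x))
    (hu : u ∈ S) (hv : v ∈ S) (hw : w ∈ S) (huv : u ≠ v) (huw : u ≠ w) (hvw : v ≠ w) :
    1 / 4 * ((if IdleQuery G O u v w then 1 else 0) + (if IdleQuery G O u w v then 1 else 0) +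
      (if IdleQuery G O v w u then 1 else 0) + (if IdleQuery G O v u w then 1 else 0) +
      (if IdleQuery G O w u v then 1 else 0) + (if IdleQuery G O w v u then 1 else 0)) ≤
    tripleRemoved G O S (order u) u v w + tripleRemoved G O S (order v) v w u +
        tripleRemoved G O S (order w) w u v := by
  have k1 := le_tripleRemoved (O := O) (hl u hu) hv hw huv huw hvw
  have k2 := le_tripleRemoved (O := O) (hl v hv) hw hu hvw huv.symm huw.symm
  have k3 := le_tripleRemoved (O := O) (hl w hw) hu hv huw.symm hvw.symm huv
  refine le_trans ?_ (add_le_add (add_le_add k1 k2) k3)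
  have r1 := hO.not_exactly_one_apart (G := G) u v w huw.symm
  have r2 := hO.not_exactly_one_apart (G := G) w u v hvw
  have r3 := hO.not_exactly_one_apart (G := G) v w u huv
  clear k1 k2 k3
  unfold IdleQuery IsPPMTriangle
  simp only [G.adj_comm v u, G.adj_comm w v, G.adj_comm u w, errs_comm hO v u,
    errs_comm hO w v, errs_comm hO u w, huv, huw, hvw, huv.symm, huw.symm, hvw.symm,
    ne_eq, not_false_eq_true, true_and]
  by_cases e1 : Errs G O u v <;> by_cases e2 : Errs G O v w <;> by_cases e3 : Errs G O w u <;>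
    simp only [e1, e2, e3, iff_true, iff_false] at r1 r2 r3 ⊢ <;>
    by_cases a1 : G.Adj u v <;> by_cases a2 : G.Adj v w <;> by_cases a3 : G.Adj w u <;>
    simp only [a1, a2, a3, not_true_eq_false, not_false_eq_true, and_true, and_false, or_true,
      or_false, if_true, if_false, and_self] at r1 r2 r3 ⊢ <;>
    norm_num

/-- Bernoulli's inequality bounds the probability of a query that finds no mistake by the expected
number of selected triangles that cause it. -/
theorem one_sub_missProb_le :
    1 - missProb G O S u v ≤
      (if Errs G O u v then 1 else 0) + 1 / 4 * ∑ w ∈ S, if IdleQuery G O u v w then 1 else 0 := by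
  have h0 := missProb_nonneg (G := G) (O := O) (S := S) (u := u) (v := v)
  split_ifs with h
  · have : (0 : ℝ) ≤ ∑ w ∈ S, if IdleQuery G O u v w then 1 else 0 :=
      Finset.sum_nonneg fun w _ => by split_ifs <;> norm_num
    linarith
  · have hb := one_add_mul_le_pow (a := (-1 / 4 : ℝ)) (by norm_num) (queryCount G O S u v)
    have : ∑ w ∈ S, (if IdleQuery G O u v w then (1 : ℝ) else 0) = queryCount G O S u v := by
      rw [← Finset.sum_filter, Finset.sum_const, nsmul_eq_mul, mul_one]
      simp only [IdleQuery, h, not_false_eq_true, true_and, queryCount]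
    rw [this]
    have e : missProb G O S u v = (1 + (-1 / 4 : ℝ)) ^ queryCount G O S u v := by
      unfold missProb; norm_num
    rw [e]; linarith

/-- In one round, the expected number of queries is at most the expected number of removed mistakes
of the reference clustering. The factor `2` is due to counting ordered pairs. -/
theorem sum_pivotExp_card_le (hO : IsClusterOracle O) {order : V → List (V × V)}
    (hl : ∀ x ∈ S, IsTriangleEnumeration G S x (order x)) :
    ∑ u ∈ S, pivotExp G O (order u) u (fun Q => 2 * (Q.card : ℝ)) ≤
    ∑ u ∈ S, pivotExp G O (order u) u
      (fun Q => ∑ x ∈ S, ∑ y ∈ S, if Removed G O (clusterOf G O S u Q) x y then 1 else 0) := by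
  have h1 : ∀ u ∈ S, pivotExp G O (order u) u
      (fun Q => ∑ x ∈ S, ∑ y ∈ S, if Removed G O (clusterOf G O S u Q) x y then 1 else 0) =
      2 * ∑ v ∈ S, (if Errs G O u v then 1 else 0) +
      ∑ v ∈ S, ∑ w ∈ S, tripleRemoved G O S (order u) u v w := by
    intro u hu
    rw [pivotExp_sum_pairs hu
      (fun Q x y => if Removed G O (clusterOf G O S u Q) x y then 1 else 0)
      (fun Q x y => by simp only [Removed, errs_comm hO x y, or_comm])
      (fun Q x => by simp [Removed, Errs])]
    congr 2
    refine Finset.sum_congr rfl fun v _ => ?_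
    rw [← pivotExp_const (G := G) (O := O) (l := order u) (u := u) (ite _ _ _)]
    refine pivotExp_congr (hl u hu) fun Q _ => ?_
    simp only [Removed, self_mem_clusterOf (G := G) (O := O) (Q := Q) hu, true_or, and_true]
  have h2 : ∀ u ∈ S, pivotExp G O (order u) u (fun Q => 2 * (Q.card : ℝ)) =
      2 * ∑ v ∈ S, (1 - missProb G O S u v) := by
    intro u hu
    have : ∀ v ∈ S, 1 - missProb G O S u v =
        pivotExp G O (order u) u (fun Q => 1 + -1 * if v ∈ Q then 0 else 1) := by
      intro v hv
      rw [pivotExp_affine (hl u hu) hv]; ring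
    rw [Finset.sum_congr rfl this, ← pivotExp_sum]
    refine (pivotExp_congr (hl u hu) fun Q hQ => ?_).trans (scanExp_const_mul 2 _ _ _)
    congr 1
    have : ∀ v, (1 + -1 * if v ∈ Q then 0 else 1 : ℝ) = if v ∈ Q then 1 else 0 := by
      intro v; split_ifs <;> norm_num
    simp only [this]
    rw [← Finset.sum_filter, Finset.sum_const, nsmul_eq_mul, mul_one,
      Finset.filter_mem_eq_inter, Finset.inter_eq_right.2 hQ]
  rw [Finset.sum_congr rfl h1, Finset.sum_congr rfl h2, Finset.sum_add_distrib]
  have h3 : ∑ u ∈ S, 2 * ∑ v ∈ S, (1 - missProb G O S u v) ≤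
      ∑ u ∈ S, 2 * ∑ v ∈ S, (if Errs G O u v then 1 else 0) +
      2 * ∑ u ∈ S, ∑ v ∈ S, ∑ w ∈ S, (1 / 4 * if IdleQuery G O u v w then 1 else 0) := by
    simp only [Finset.mul_sum, ← Finset.sum_add_distrib]
    refine Finset.sum_le_sum fun u _ => Finset.sum_le_sum fun v _ => ?_
    have := one_sub_missProb_le (G := G) (O := O) (S := S) (u := u) (v := v)
    rw [← Finset.mul_sum, ← Finset.mul_sum]
    linarith
  have h4 := sum_le_sum_of_cyclic S
    (fun u v w => 1 / 4 * ((if IdleQuery G O u v w then 1 else 0) +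
      (if IdleQuery G O u w v then 1 else 0)))
    (fun u v w => tripleRemoved G O S (order u) u v w) fun u hu v hv w hw => by
      by_cases h : u ≠ v ∧ u ≠ w ∧ v ≠ w
      · have := idleQuery_cyclic hO hl hu hv hw h.1 h.2.1 h.2.2
        linarith
      · have h1 : ¬ (v ≠ w ∧ v ≠ u ∧ w ≠ u) := by grind
        have h2 : ¬ (w ≠ u ∧ w ≠ v ∧ u ≠ v) := by grind
        have h0 : ∀ a b c : V, ¬ (a ≠ b ∧ a ≠ c ∧ b ≠ c) →
            ¬ IdleQuery G O a b c ∧ ¬ IdleQuery G O a c b := by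
          intro a b c; unfold IdleQuery IsPPMTriangle; grind
        unfold tripleRemoved
        simp [h0 _ _ _ h, h0 _ _ _ h1, h0 _ _ _ h2, if_neg h, if_neg h1, if_neg h2]
  have h5 : ∑ u ∈ S, ∑ v ∈ S, ∑ w ∈ S, (1 / 4 * ((if IdleQuery G O u v w then (1 : ℝ) else 0) +
      (if IdleQuery G O u w v then 1 else 0))) =
      2 * ∑ u ∈ S, ∑ v ∈ S, ∑ w ∈ S, (1 / 4 * if IdleQuery G O u v w then 1 else 0) := by
    rw [two_mul, ← Finset.sum_add_distrib]
    refine Finset.sum_congr rfl fun u _ => ?_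
    simp only [mul_add, Finset.sum_add_distrib]
    congr 1
    exact Finset.sum_comm
  linarith

/-! ### Expectations with respect to a probability mass function -/

section mean
variable {α β : Type*}

/-- The expectation of a function with values in the extended nonnegative reals. On functions with
values in `ℕ` it agrees with `expectation` by definition. -/
noncomputable def mean (μ : PMF α) (g : α → ℝ≥0∞) : ℝ≥0∞ :=
  ∑' a, μ a * g a

theorem mean_pure (a : α) (g : α → ℝ≥0∞) : mean (PMF.pure a) g = g a := by
  unfold mean
  rw [tsum_eq_single a]
  · simp
  · intro b hb; simp [PMF.pure_apply, hb]

theorem mean_bind (μ : PMF α) (f : α → PMF β) (g : β → ℝ≥0∞) :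
    mean (μ.bind f) g = mean μ fun a => mean (f a) g := by
  unfold mean
  simp only [PMF.bind_apply, ← ENNReal.tsum_mul_right, ← ENNReal.tsum_mul_left]
  rw [ENNReal.tsum_comm]
  simp only [mul_assoc]

theorem mean_map (μ : PMF α) (f : α → β) (g : β → ℝ≥0∞) :
    mean (μ.map f) g = mean μ fun a => g (f a) := by
  unfold PMF.map
  rw [mean_bind]
  simp only [Function.comp, mean_pure]

theorem mean_mono {μ : PMF α} {f g : α → ℝ≥0∞} (h : ∀ a ∈ μ.support, f a ≤ g a) :
    mean μ f ≤ mean μ g := by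
  refine ENNReal.tsum_le_tsum fun a => ?_
  by_cases ha : μ a = 0
  · simp [ha]
  · gcongr; exact h a ((PMF.mem_support_iff _ _).2 ha)

theorem mean_add (μ : PMF α) (f g : α → ℝ≥0∞) :
    mean μ (fun a => f a + g a) = mean μ f + mean μ g := by
  unfold mean; simp only [mul_add, ENNReal.tsum_add]

theorem mean_const (μ : PMF α) (c : ℝ≥0∞) : mean μ (fun _ => c) = c := by
  unfold mean; rw [ENNReal.tsum_mul_right, μ.tsum_coe, one_mul]

theorem mean_mul (μ : PMF α) (c : ℝ≥0∞) (f : α → ℝ≥0∞) :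
    mean μ (fun a => c * f a) = c * mean μ f := by
  unfold mean; rw [← ENNReal.tsum_mul_left]; simp only [mul_left_comm]

theorem mean_uniformOfFintype (S : Finset α) [Nonempty S] (g : α → ℝ≥0∞) :
    mean (PMF.uniformOfFintype S) (fun u => g u) = (S.card : ℝ≥0∞)⁻¹ * ∑ u ∈ S, g u := by
  unfold mean
  simp only [PMF.uniformOfFintype_apply, tsum_fintype, Fintype.card_coe, ← Finset.mul_sum]
  rw [Finset.sum_coe_sort S g]

theorem mean_coin {p : ℝ≥0} (hp : p ≤ 1) (g : Bool → ℝ≥0∞) :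
    mean (coin p hp) g = p * g true + (1 - p) * g false := by
  unfold mean coin
  simp [tsum_fintype]

end mean

/-! ### The scan of the triangles at a pivot -/

theorem query_errs (huv : u ≠ v) (Q : Finset V) :
    query G O u v ⟨Q, Q.filter (Errs G O u)⟩ =
      ⟨insert v Q, (insert v Q).filter (Errs G O u)⟩ := by
  unfold query
  by_cases hv : v ∈ Q
  · simp [hv]
  · by_cases h : O u v = decide (G.Adj u v) <;>
      simp [hv, h, Finset.filter_insert, Errs, huv]

theorem processTriangle_errs {t : V × V} (h₁ : u ≠ t.1) (h₂ : u ≠ t.2) (Q : Finset V) :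
    processTriangle G O u t ⟨Q, Q.filter (Errs G O u)⟩ =
      ⟨Q ∪ toQuery G O u t, (Q ∪ toQuery G O u t).filter (Errs G O u)⟩ := by
  unfold processTriangle toQuery
  simp only [query_errs h₁, query_errs h₂]
  have h : t.1 ∉ (insert t.1 Q).filter (Errs G O u) ↔ ¬ Errs G O u t.1 := by simp
  simp only [h]
  have e1 : insert t.2 (insert t.1 Q) = Q ∪ {t.1, t.2} := by ext; simp; tauto
  have e2 : insert t.1 Q = Q ∪ {t.1} := by rw [Finset.insert_eq, Finset.union_comm]
  split_ifs
  · rw [e1]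
  · rw [e2]

/-- In every state reached by the scan, the recorded mistakes are the mistakes of the reference
clustering among the queried edges, so that expectations can be computed by `scanExp` from the
queried set alone. -/
theorem mean_scan {p : ℝ≥0} (hp : p ≤ 1) (l : List (V × V))
    (hl : ∀ t ∈ l, u ≠ t.1 ∧ u ≠ t.2) (g : ScanState V → ℝ≥0∞) (f : Finset V → ℝ)
    (hf : ∀ Q, 0 ≤ f Q) (hg : ∀ Q, g ⟨Q, Q.filter (Errs G O u)⟩ = ENNReal.ofReal (f Q))
    (Q : Finset V) :
    mean (scan G O p hp u l ⟨Q, Q.filter (Errs G O u)⟩) g =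
      ENNReal.ofReal (scanExp p (toQuery G O u) f l Q) := by
  have hp' : (p : ℝ) ≤ 1 := by exact_mod_cast hp
  have hnn : ∀ (l : List (V × V)) (Q : Finset V), 0 ≤ scanExp p (toQuery G O u) f l Q := by
    intro l
    have hp1 : (0 : ℝ) ≤ 1 - p := sub_nonneg.2 hp'
    induction l with
    | nil => exact hf
    | cons t l ih =>
      intro Q
      exact add_nonneg (mul_nonneg p.coe_nonneg (ih _)) (mul_nonneg hp1 (ih _))
  induction l generalizing Q with
  | nil => rw [scan, mean_pure, hg]; rfl
  | cons t l ih =>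
    have hl' : ∀ t ∈ l, u ≠ t.1 ∧ u ≠ t.2 := fun t ht => hl t (List.mem_cons_of_mem _ ht)
    obtain ⟨h₁, h₂⟩ := hl t List.mem_cons_self
    have hp1 : (0 : ℝ) ≤ 1 - p := sub_nonneg.2 hp'
    rw [scan, mean_bind, mean_coin]
    simp only [if_true, Bool.false_eq_true, if_false]
    rw [processTriangle_errs h₁ h₂, ih hl', ih hl', scanExp,
      ENNReal.ofReal_add (mul_nonneg p.coe_nonneg (hnn _ _)) (mul_nonneg hp1 (hnn _ _)),
      ENNReal.ofReal_mul p.coe_nonneg, ENNReal.ofReal_mul hp1, ENNReal.ofReal_sub _ p.coe_nonneg]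
    simp

/-! ### The recursion of the algorithm -/

theorem exists_finpartition_of_mem_support {order : Finset V → V → List (V × V)} {p : ℝ≥0}
    {hp : p ≤ 1} (S : Finset V) :
    ∀ r ∈ (randomQueryPivot G O order p hp S).support,
      ∃ P : Finpartition S, P.parts = r.clusters := by
  induction S using Finset.strongInduction with
  | H S ih =>
  intro r hr
  rw [randomQueryPivot] at hr
  split_ifs at hr with hS
  · simp only [PMF.mem_support_bind_iff, PMF.support_map, Set.mem_image] at hr
    obtain ⟨u, -, s, -, r', hr', rfl⟩ := hr
    have hlt : S \ pivotCluster G S u s.mistake ⊂ S :=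
      (Finset.ssubset_iff_of_subset Finset.sdiff_subset).2 ⟨u, u.2, by simp [pivotCluster]⟩
    obtain ⟨P, hP⟩ := ih _ hlt r' hr'
    have hsub : pivotCluster G S u s.mistake ⊆ S := Finset.filter_subset _ _
    refine ⟨P.extend (b := pivotCluster G S u s.mistake) (c := S) ?_ ?_ ?_, ?_⟩
    · exact Finset.ne_empty_of_mem (a := (u : V)) (by simp [pivotCluster])
    · exact Finset.sdiff_disjoint
    · exact Finset.sdiff_union_of_subset hsub
    · simp [hP]
  · rw [Finset.not_nonempty_iff_eq_empty] at hS
    subst hS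
    simp only [PMF.mem_support_pure_iff] at hr
    subst hr
    exact ⟨⊥, by simp⟩

/-- The number of ordered pairs in `S` on which the reference clustering makes a mistake, which is
twice the number of mistakes inside `S`. -/
def errCount (G : SimpleGraph V) [DecidableRel G.Adj] (O : V → V → Bool) (S : Finset V) : ℕ :=
  ∑ x ∈ S, ∑ y ∈ S, if Errs G O x y then 1 else 0

/-- The number of ordered pairs in `S` that are mistakes of the reference clustering and are removed
with the cluster `C`. -/
def removedCount (G : SimpleGraph V) [DecidableRel G.Adj] (O : V → V → Bool) (S C : Finset V) :
    ℕ :=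
  ∑ x ∈ S, ∑ y ∈ S, if Removed G O C x y then 1 else 0

theorem sum_pairs_sdiff (S C : Finset V) (φ : V → V → ℕ) :
    ∑ x ∈ S, ∑ y ∈ S, φ x y = ∑ x ∈ S, ∑ y ∈ S, (if x ∈ C ∨ y ∈ C then φ x y else 0) +
      ∑ x ∈ S \ C, ∑ y ∈ S \ C, φ x y := by
  simp only [Finset.sdiff_eq_filter, Finset.sum_filter]
  rw [← Finset.sum_add_distrib]
  refine Finset.sum_congr rfl fun x _ => ?_
  by_cases hx : x ∈ C
  · simp [hx]
  · simp only [hx, false_or, not_false_eq_true, if_true, ← Finset.sum_add_distrib]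
    refine Finset.sum_congr rfl fun y _ => ?_
    split_ifs <;> simp

theorem errCount_eq (S C : Finset V) :
    errCount G O S = removedCount G O S C + errCount G O (S \ C) := by
  unfold errCount removedCount
  rw [sum_pairs_sdiff S C]
  congr 1
  refine Finset.sum_congr rfl fun x _ => Finset.sum_congr rfl fun y _ => ?_
  unfold Removed
  by_cases h : x ∈ C ∨ y ∈ C <;> simp [h]

/-- If a round at the vertex set `S` increases a value `val` by at most `cost`, and the expected
cost is at most `K` times the expected number of removed mistakes of the reference clustering (as
ordered pairs), then the expected value of the output is at most `K` times the number of all these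
mistakes. Both expected numbers of a round are summed, not averaged, over the pivots. -/
theorem mean_randomQueryPivot_le {order : Finset V → V → List (V × V)} {p : ℝ≥0}
    {hp : p ≤ 1} (K : ℕ) (val : Finset V → Output V → ℕ) (cost : Finset V → V → ScanState V → ℕ)
    (h0 : val ∅ ⟨∅, 0⟩ = 0)
    (hstep : ∀ (S : Finset V) (u : V) (s : ScanState V) (r : Output V), u ∈ S →
      (∃ P : Finpartition (S \ pivotCluster G S u s.mistake), P.parts = r.clusters) →
      val S ⟨insert (pivotCluster G S u s.mistake) r.clusters, s.queried.card + r.queries⟩ ≤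
        cost S u s + val (S \ pivotCluster G S u s.mistake) r)
    (hcost : ∀ S : Finset V,
      ∑ u ∈ S, mean (scan G O p hp u (order S u) ⟨∅, ∅⟩) (fun s => cost S u s) ≤
      ∑ u ∈ S, mean (scan G O p hp u (order S u) ⟨∅, ∅⟩)
        (fun s => K * removedCount G O S (pivotCluster G S u s.mistake)))
    (S : Finset V) :
    mean (randomQueryPivot G O order p hp S) (fun r => val S r) ≤ K * errCount G O S := by
  induction S using Finset.strongInduction with
  | H S ih =>
  rw [randomQueryPivot]
  split_ifs with hS
  · have : Nonempty S := hS.to_subtype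
    simp only [mean_bind, mean_map]
    calc _ ≤ mean (PMF.uniformOfFintype S) fun u =>
            mean (scan G O p hp u (order S u) ⟨∅, ∅⟩) fun s =>
              cost S u s + K * errCount G O (S \ pivotCluster G S u s.mistake) := by
          refine mean_mono fun u _ => mean_mono fun s _ => ?_
          have hlt : S \ pivotCluster G S u s.mistake ⊂ S :=
            (Finset.ssubset_iff_of_subset Finset.sdiff_subset).2 ⟨u, u.2, by simp [pivotCluster]⟩
          refine le_trans ?_ (add_le_add_right (ih _ hlt) _)
          rw [← mean_const (randomQueryPivot G O order p hp (S \ pivotCluster G S u s.mistake))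
            (cost S u s : ℝ≥0∞), ← mean_add]
          refine mean_mono fun r hr => ?_
          have := hstep S u s r u.2 (exists_finpartition_of_mem_support _ r hr)
          exact_mod_cast this
      _ ≤ mean (PMF.uniformOfFintype S) fun u =>
            mean (scan G O p hp u (order S u) ⟨∅, ∅⟩) fun s =>
              K * removedCount G O S (pivotCluster G S u s.mistake) +
                K * errCount G O (S \ pivotCluster G S u s.mistake) := by
          simp only [mean_add]
          gcongr ?_ + _
          rw [mean_uniformOfFintype S fun u =>
              mean (scan G O p hp u (order S u) ⟨∅, ∅⟩) fun s => (cost S u s : ℝ≥0∞),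
            mean_uniformOfFintype S fun u =>
              mean (scan G O p hp u (order S u) ⟨∅, ∅⟩) fun s =>
                (K * removedCount G O S (pivotCluster G S u s.mistake) : ℝ≥0∞)]
          exact mul_le_mul' le_rfl (hcost S)
      _ = K * errCount G O S := by
          simp only [← mul_add, ← Nat.cast_add, ← errCount_eq, mean_const]
  · rw [Finset.not_nonempty_iff_eq_empty] at hS
    subst hS
    rw [mean_pure, h0]
    simp

/-! ### Mistakes of a clustering, counted by ordered pairs -/

/-- The clustering `P` makes a mistake on the edge `{x, y}`. -/
def Disagree (G : SimpleGraph V) (P : Finset (Finset V)) (x y : V) : Prop :=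
  x ≠ y ∧ (Together P x y ↔ ¬ G.Adj x y)

instance (G : SimpleGraph V) [DecidableRel G.Adj] (P : Finset (Finset V)) (x y : V) :
    Decidable (Disagree G P x y) :=
  inferInstanceAs (Decidable (x ≠ y ∧ (Together P x y ↔ ¬ G.Adj x y)))

/-- The number of ordered pairs in `S` on which the clustering `P` makes a mistake. -/
def disagreeCount (G : SimpleGraph V) [DecidableRel G.Adj] (P : Finset (Finset V))
    (S : Finset V) : ℕ :=
  ∑ x ∈ S, ∑ y ∈ S, if Disagree G P x y then 1 else 0

theorem two_mul_mistakes [Fintype V] (P : Finset (Finset V)) :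
    2 * mistakes G P = disagreeCount G P Finset.univ := by
  classical
  let H : SimpleGraph V :=
    { Adj := Disagree G P
      symm := ⟨fun x y h => ⟨h.1.symm, by rw [together_comm, G.adj_comm]; exact h.2⟩⟩
      loopless := ⟨fun x h => h.1 rfl⟩ }
  have hH : ∀ x y, H.Adj x y ↔ Disagree G P x y := fun _ _ => Iff.rfl
  have hE : H.edgeFinset = (G.edgeFinset.filter fun e => ¬ TogetherPair P e) ∪
      (Gᶜ.edgeFinset.filter fun e => TogetherPair P e) := by
    ext e
    induction e with
    | h x y =>
      have h1 : TogetherPair P s(x, y) ↔ Together P x y := Iff.rfl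
      have h2 : G.Adj x y → x ≠ y := G.ne_of_adj
      simp only [SimpleGraph.mem_edgeFinset, SimpleGraph.mem_edgeSet, hH, Disagree,
        Finset.mem_union, Finset.mem_filter, SimpleGraph.compl_adj, h1]
      tauto
  have hd : Disjoint (G.edgeFinset.filter fun e => ¬ TogetherPair P e)
      (Gᶜ.edgeFinset.filter fun e => TogetherPair P e) := by
    rw [Finset.disjoint_left]
    intro e he he'
    exact (Finset.mem_filter.1 he).2 (Finset.mem_filter.1 he').2
  have hc : H.edgeFinset.card = mistakes G P := by
    rw [hE, Finset.card_union_of_disjoint hd]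
    unfold mistakes
    congr! 2
  rw [← hc, ← H.sum_degrees_eq_twice_card_edges]
  unfold disagreeCount
  refine Finset.sum_congr rfl fun x _ => ?_
  rw [← Finset.sum_filter, Finset.sum_const, smul_eq_mul, mul_one,
    ← H.card_neighborFinset_eq_degree]
  congr 1
  ext y
  simp [hH]

theorem together_insert_of_mem {C : Finset V} {P : Finpartition (S \ C)} (hu : u ∈ C) :
    Together (insert C P.parts) u v ↔ v ∈ C := by
  constructor
  · rintro ⟨D, hD, huD, hvD⟩
    rcases Finset.mem_insert.1 hD with rfl | hD
    · exact hvD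
    · exact absurd hu (Finset.mem_sdiff.1 (P.le hD huD)).2
  · exact fun hv => ⟨C, Finset.mem_insert_self _ _, hu, hv⟩

theorem together_insert_of_notMem {C : Finset V} {P : Finset (Finset V)} (hu : u ∉ C) :
    Together (insert C P) u v ↔ Together P u v := by
  constructor
  · rintro ⟨D, hD, huD, hvD⟩
    rcases Finset.mem_insert.1 hD with rfl | hD
    · exact absurd huD hu
    · exact ⟨D, hD, huD, hvD⟩
  · exact fun ⟨D, hD, h⟩ => ⟨D, Finset.mem_insert_of_mem hD, h⟩

/-- Splitting off a cluster `C` in front of a partition of the remaining vertices adds the mistakes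
of the algorithm on the edges that meet `C`. -/
theorem disagreeCount_insert {C : Finset V} (P : Finpartition (S \ C)) :
    disagreeCount G (insert C P.parts) S =
      ∑ x ∈ S, ∑ y ∈ S, (if AlgErrs G C x y then 1 else 0) + disagreeCount G P.parts (S \ C) := by
  unfold disagreeCount
  rw [sum_pairs_sdiff S C]
  congr 1
  · refine Finset.sum_congr rfl fun x _ => Finset.sum_congr rfl fun y _ => ?_
    have h1 := together_insert_of_mem (P := P) (u := x) (v := y)
    have h2 := together_insert_of_mem (P := P) (u := y) (v := x)
    rw [together_comm] at h2
    unfold Disagree AlgErrs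
    grind
  · refine Finset.sum_congr rfl fun x hx => Finset.sum_congr rfl fun y _ => ?_
    have : Disagree G (insert C P.parts) x y ↔ Disagree G P.parts x y := by
      simp only [Disagree, together_insert_of_notMem (Finset.mem_sdiff.1 hx).2]
    simp only [this]

theorem isClusterOracle_sameClusterOracle (P : Finpartition S) :
    IsClusterOracle (sameClusterOracle P.parts) where
  symm x y := by simp only [sameClusterOracle, together_comm]
  trans x y z := by
    simp only [sameClusterOracle, decide_eq_true_eq]
    rintro ⟨C, hC, hx, hy⟩ ⟨D, hD, hy', hz⟩
    obtain rfl := P.eq_of_mem_parts hC hD hy hy'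
    exact ⟨C, hC, hx, hz⟩

theorem errs_sameClusterOracle (P : Finset (Finset V)) (x y : V) :
    Errs G (sameClusterOracle P) x y ↔ Disagree G P x y := by
  unfold Errs Disagree sameClusterOracle
  by_cases h1 : Together P x y <;> by_cases h2 : G.Adj x y <;> simp [h1, h2]

theorem errCount_sameClusterOracle [Fintype V] (P : Finset (Finset V)) :
    errCount G (sameClusterOracle P) Finset.univ = 2 * mistakes G P := by
  rw [two_mul_mistakes]
  simp only [errCount, disagreeCount, errs_sameClusterOracle]

/-! ### The expected numbers of mistakes and queries -/

theorem mean_scan_pivot (hl : IsTriangleEnumeration G S u l) (c : ScanState V → ℕ)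
    (f : Finset V → ℝ) (hf : ∀ Q, (c ⟨Q, Q.filter (Errs G O u)⟩ : ℝ) = f Q) :
    mean (scan G O (1 / 4) quarter_le_one u l ⟨∅, ∅⟩) (fun s => (c s : ℝ≥0∞)) =
      ENNReal.ofReal (pivotExp G O l u f) := by
  have hne : ∀ t ∈ l, u ≠ t.1 ∧ u ≠ t.2 := fun t ht =>
    ⟨(hl.sound t ht).2.2.1.1, (hl.sound t ht).2.2.1.2.1⟩
  have := mean_scan (G := G) (O := O) quarter_le_one l hne (fun s => (c s : ℝ≥0∞)) f
    (fun Q => by rw [← hf]; positivity)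
    (fun Q => by rw [← hf, ENNReal.ofReal_natCast]) ∅
  rw [Finset.filter_empty] at this
  rw [this]
  unfold pivotExp
  norm_num

/-- Transfer of an inequality between real expectations of one round to the algorithm. -/
theorem sum_mean_scan_le {order : V → List (V × V)}
    (hl : ∀ u ∈ S, IsTriangleEnumeration G S u (order u)) (c d : V → ScanState V → ℕ)
    (f g : V → Finset V → ℝ) (hf : ∀ u Q, (c u ⟨Q, Q.filter (Errs G O u)⟩ : ℝ) = f u Q)
    (hg : ∀ u Q, (d u ⟨Q, Q.filter (Errs G O u)⟩ : ℝ) = g u Q)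
    (h : ∑ u ∈ S, pivotExp G O (order u) u (f u) ≤ ∑ u ∈ S, pivotExp G O (order u) u (g u)) :
    ∑ u ∈ S, mean (scan G O (1 / 4) quarter_le_one u (order u) ⟨∅, ∅⟩)
        (fun s => (c u s : ℝ≥0∞)) ≤
      ∑ u ∈ S, mean (scan G O (1 / 4) quarter_le_one u (order u) ⟨∅, ∅⟩)
        (fun s => (d u s : ℝ≥0∞)) := by
  have hnn : ∀ (c : V → ScanState V → ℕ) (f : V → Finset V → ℝ),
      (∀ u Q, (c u ⟨Q, Q.filter (Errs G O u)⟩ : ℝ) = f u Q) →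
      ∀ u ∈ S, 0 ≤ pivotExp G O (order u) u (f u) := by
    intro c f hf u hu
    rw [← pivotExp_const (G := G) (O := O) (l := order u) (u := u) 0]
    exact pivotExp_mono (hl u hu) fun Q _ => by rw [← hf]; positivity
  rw [Finset.sum_congr rfl fun u hu => mean_scan_pivot (hl u hu) (c u) (f u) (hf u),
    Finset.sum_congr rfl fun u hu => mean_scan_pivot (hl u hu) (d u) (g u) (hg u),
    ← ENNReal.ofReal_sum_of_nonneg (hnn c f hf), ← ENNReal.ofReal_sum_of_nonneg (hnn d g hg)]
  exact ENNReal.ofReal_le_ofReal h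

theorem mean_disagreeCount_le (hO : IsClusterOracle O) {order : Finset V → V → List (V × V)}
    (hl : ∀ S : Finset V, ∀ u ∈ S, IsTriangleEnumeration G S u (order S u)) (S : Finset V) :
    mean (randomQueryPivot G O order (1 / 4) quarter_le_one S)
      (fun r => disagreeCount G r.clusters S) ≤ 2 * errCount G O S := by
  refine mean_randomQueryPivot_le 2 (fun S r => disagreeCount G r.clusters S)
    (fun S u s => ∑ x ∈ S, ∑ y ∈ S, if AlgErrs G (pivotCluster G S u s.mistake) x y then 1 else 0)
    (by simp [disagreeCount]) ?_ ?_ S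
  · rintro S u s r - ⟨P, hP⟩
    dsimp only
    rw [← hP, disagreeCount_insert P]
  · intro S
    have := sum_mean_scan_le (O := O) (hl S)
      (fun u s => ∑ x ∈ S, ∑ y ∈ S,
        if AlgErrs G (pivotCluster G S u s.mistake) x y then 1 else 0)
      (fun u s => 2 * removedCount G O S (pivotCluster G S u s.mistake))
      (fun u Q => ∑ x ∈ S, ∑ y ∈ S, if AlgErrs G (clusterOf G O S u Q) x y then 1 else 0)
      (fun u Q => 2 * ∑ x ∈ S, ∑ y ∈ S, if Removed G O (clusterOf G O S u Q) x y then 1 else 0)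
      (fun u Q => by push_cast; rfl) (fun u Q => by simp only [removedCount]; push_cast; rfl) ?_
    · exact_mod_cast this
    · have h := sum_pivotExp_excess_nonpos hO (hl S)
      have e : ∀ u, pivotExp G O (order S u) u
          (fun Q => ∑ x ∈ S, ∑ y ∈ S, excess G O (clusterOf G O S u Q) x y) =
          pivotExp G O (order S u) u (fun Q => ∑ x ∈ S, ∑ y ∈ S,
            if AlgErrs G (clusterOf G O S u Q) x y then 1 else 0) -
          pivotExp G O (order S u) u (fun Q => 2 * ∑ x ∈ S, ∑ y ∈ S,
            if Removed G O (clusterOf G O S u Q) x y then 1 else 0) := by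
        intro u
        rw [eq_sub_iff_add_eq]
        unfold pivotExp
        rw [← scanExp_add]
        congr 1
        funext Q
        simp only [excess, Finset.sum_sub_distrib, Finset.mul_sum]
        ring
      simp only [e, Finset.sum_sub_distrib] at h
      linarith

theorem mean_queries_le (hO : IsClusterOracle O) {order : Finset V → V → List (V × V)}
    (hl : ∀ S : Finset V, ∀ u ∈ S, IsTriangleEnumeration G S u (order S u)) (S : Finset V) :
    mean (randomQueryPivot G O order (1 / 4) quarter_le_one S)
      (fun r => ((2 * r.queries : ℕ) : ℝ≥0∞)) ≤ errCount G O S := by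
  have := mean_randomQueryPivot_le (G := G) (O := O) (order := order) (hp := quarter_le_one) 1
    (fun _ r => 2 * r.queries) (fun _ _ s => 2 * s.queried.card) rfl ?_ ?_ S
  · simpa using this
  · rintro S u s r - -
    exact (mul_add _ _ _).le
  · intro S
    have := sum_mean_scan_le (O := O) (hl S) (fun _ s => 2 * s.queried.card)
      (fun u s => 1 * removedCount G O S (pivotCluster G S u s.mistake))
      (fun _ Q => 2 * (Q.card : ℝ))
      (fun u Q => ∑ x ∈ S, ∑ y ∈ S, if Removed G O (clusterOf G O S u Q) x y then 1 else 0)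
      (fun u Q => by push_cast; rfl)
      (fun u Q => by simp only [removedCount, one_mul]; push_cast; rfl)
      (sum_pivotExp_card_le hO (hl S))
    exact_mod_cast this

end CorrelationClustering

theorem mainTheorem3 {V : Type*} [Fintype V] [DecidableEq V] (G : SimpleGraph V)
    [DecidableRel G.Adj] (OPT : Finpartition (Finset.univ : Finset V))
    (hOPT : CorrelationClustering.IsOptimal G OPT)
    (order : Finset V → V → List (V × V))
    (horder : ∀ S : Finset V, ∀ u ∈ S,
      CorrelationClustering.IsTriangleEnumeration G S u (order S u)) :
    (∀ r ∈ (CorrelationClustering.randomQueryPivot G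
        (CorrelationClustering.sameClusterOracle OPT.parts) order (1 / 4)
        CorrelationClustering.quarter_le_one Finset.univ).support,
      ∃ P : Finpartition (Finset.univ : Finset V), P.parts = r.clusters) ∧
    CorrelationClustering.expectation
        (CorrelationClustering.randomQueryPivot G
          (CorrelationClustering.sameClusterOracle OPT.parts) order (1 / 4)
          CorrelationClustering.quarter_le_one Finset.univ)
        (fun r => CorrelationClustering.mistakes G r.clusters) ≤
      2 * (CorrelationClustering.mistakes G OPT.parts : ENNReal) ∧
    CorrelationClustering.expectation
        (CorrelationClustering.randomQueryPivot G
          (CorrelationClustering.sameClusterOracle OPT.parts) order (1 / 4)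
          CorrelationClustering.quarter_le_one Finset.univ)
        (fun r => r.queries) ≤
      (CorrelationClustering.mistakes G OPT.parts : ENNReal) := by
  open CorrelationClustering in
  have hO := isClusterOracle_sameClusterOracle OPT
  have hm := mean_disagreeCount_le hO horder Finset.univ
  have hq := mean_queries_le hO horder Finset.univ
  -- Both bounds count ordered pairs; the common factor `2` is cancelled at the end.
  simp only [← two_mul_mistakes, errCount_sameClusterOracle, Nat.cast_mul, Nat.cast_ofNat,
    mean_mul] at hm hq
  have h2 : ∀ a b : ENNReal, 2 * a ≤ 2 * b → a ≤ b := fun a b h =>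
    (ENNReal.mul_le_mul_iff_right (by norm_num) (by norm_num)).1 h
  exact ⟨exists_finpartition_of_mem_support _, h2 _ _ hm, h2 _ _ hq⟩
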